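/- Let $\alpha \in \mathbb{R}$, $\alpha \neq 0$, and let $$\mathcal{F} = \bigoplus_{n \geq 0} L^2(\mathbb{R}_+, dx; \mathbb{C})^{\otimes n} = \mathbb{C}\Omega \oplus L^2(\mathbb{R}_+;\mathbb{C}) \oplus \cdots$$ be the full Fock space of $L^2(\mathbb{R}_+, dx)$ with its standard inner product (linear in the second argument) and vacuum vector $\Omega$. For real-valued $g \in L^1(\mathbb{R}_+) \cap L^2(\mathbb{R}_+)$ let $X(g)$ be the bounded operator on $\mathcal{F}$ determined by $X(g)\Omega = g$ and, for $n \geq 1$, $$X(g)(f_1 \otimes \cdots \otimes f_n) = g \otimes f_1 \otimes \cdots \otimes f_n + \alpha \Bigl(\int_{\mathbb{R}_+} g\,dx\Bigr) f_1 \otimes \cdots \otimes f_n + \langle g, f_1 \rangle\, f_2 \otimes \cdots \otimes f_n .$$ Put $X(t) = X(\mathbf{1}_{[0,t)})$, $T = 1/\alpha^2$, $C_T = 1 + \alpha X(T)$, let $\mathcal{A}_T = W^*(\{X(t) : 0 \leq t \leq T\})$ be the von Neumann algebra on $\mathcal{F}$ generated by the operators $X(t)$, $0 \le t \le T$, and define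 on $\mathcal{A}_T$ the linear functionals $$\phi[A] = \langle \Omega, A\Omega\rangle, \qquad \psi_T[A] = \phi[A C_T] = \langle \Omega, A C_T \Omega \rangle .$$ Then on $\mathcal{A}_T$ both $\phi$ and $\psi_T$ are faithful normal states, and moreover $\psi_T$ is tracial: $\psi_T[AB] = \psi_T[BA]$ for all $A, B \in \mathcal{A}_T$. -/

import Mathlib

open MeasureTheory
open scoped ENNReal InnerProductSpace Topology

noncomputable section

namespace TwoStateFree

/-! ### The full Fock space over `L²(ℝ₊)` -/

/-- Lebesgue measure on the half-line `ℝ₊ = [0, ∞)`. -/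
def halfLine : Measure ℝ := volume.restrict (Set.Ici 0)

instance : SigmaFinite halfLine := by unfold halfLine; infer_instance

/-- Lebesgue measure on `ℝ₊ⁿ`. -/
def orthant (n : ℕ) : Measure (Fin n → ℝ) := Measure.pi fun _ => halfLine

instance (n : ℕ) : SigmaFinite (orthant n) := by unfold orthant; infer_instance

/-- The (complexified) one-particle space `L²(ℝ₊, dx)`. -/
abbrev OneParticle : Type := Lp ℂ 2 halfLine

/-- The `n`-particle space: the Hilbert space tensor power `L²(ℝ₊)^{⊗ n}`, realized as
`L²(ℝ₊ⁿ)`, where `f₁ ⊗ ⋯ ⊗ fₙ` is the function `x ↦ f₁ (x 0) ⋯ fₙ (x (n - 1))`.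
For `n = 0` it is one-dimensional. -/
abbrev Particles (n : ℕ) : Type := Lp ℂ 2 (orthant n)

/-- The full Fock space of `L²(ℝ₊)`: the Hilbert space direct sum of all `L²(ℝ₊)^{⊗ n}`. -/
abbrev Fock : Type := lp Particles 2

/-- The constant function `1` on the one-point space `ℝ₊⁰` is square integrable. -/
theorem memLp_one_orthant_zero : MemLp (fun _ : Fin 0 → ℝ => (1 : ℂ)) 2 (orthant 0) := by
  have : IsFiniteMeasure (orthant 0) := by
    unfold orthant; rw [Measure.pi_of_empty]; infer_instance
  exact memLp_const 1

/-- The vacuum vector `Ω`. -/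
def vacuum : Fock := lp.single 2 0 (memLp_one_orthant_zero.toLp _)

/-! ### Creation and annihilation operators -/

theorem measurePreserving_headTail (n : ℕ) :
    MeasurePreserving (fun x : Fin (n + 1) → ℝ => (x 0, Fin.tail x)) (orthant (n + 1))
      (halfLine.prod (orthant n)) :=
  measurePreserving_piFinSuccAbove (fun _ : Fin (n + 1) => halfLine) 0

theorem eLpNorm_tensor (n : ℕ) {g : ℝ → ℂ} {f : (Fin n → ℝ) → ℂ}
    (hg : AEStronglyMeasurable g halfLine) (hf : AEStronglyMeasurable f (orthant n)) :
    eLpNorm (fun x : Fin (n + 1) → ℝ => g (x 0) * f (Fin.tail x)) 2 (orthant (n + 1)) =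
      eLpNorm g 2 halfLine * eLpNorm f 2 (orthant n) := by
  have hm : AEStronglyMeasurable (fun z : ℝ × (Fin n → ℝ) => g z.1 * f z.2)
      (halfLine.prod (orthant n)) := hg.comp_fst.mul hf.comp_snd
  have h1 := eLpNorm_comp_measurePreserving (p := 2) hm (measurePreserving_headTail n)
  have h2 : eLpNorm (fun z : ℝ × (Fin n → ℝ) => g z.1 * f z.2) 2 (halfLine.prod (orthant n)) =
      eLpNorm g 2 halfLine * eLpNorm f 2 (orthant n) := by
    simp only [eLpNorm_eq_lintegral_rpow_enorm_toReal (two_ne_zero) (ENNReal.ofNat_ne_top),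
      enorm_mul, ENNReal.toReal_ofNat]
    rw [← ENNReal.mul_rpow_of_nonneg _ _ (by norm_num), ← lintegral_prod_mul]
    · simp_rw [ENNReal.mul_rpow_of_nonneg _ _ (zero_le_two)]
    · exact hg.enorm.pow_const _
    · exact hf.enorm.pow_const _
  exact h1.trans h2

theorem memLp_tensor (n : ℕ) {g : ℝ → ℂ} {f : (Fin n → ℝ) → ℂ}
    (hg : MemLp g 2 halfLine) (hf : MemLp f 2 (orthant n)) :
    MemLp (fun x : Fin (n + 1) → ℝ => g (x 0) * f (Fin.tail x)) 2 (orthant (n + 1)) := by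
  refine ⟨(hg.1.comp_fst.mul hf.1.comp_snd).comp_measurePreserving
    (measurePreserving_headTail n), ?_⟩
  rw [eLpNorm_tensor n hg.1 hf.1]
  exact ENNReal.mul_lt_top hg.2 hf.2

/-- The tensor `g ⊗ f`, i.e. the function `x ↦ g (x 0) * f (x 1, …, x n)`. -/
def tensor {n : ℕ} (g : OneParticle) (f : Particles n) : Particles (n + 1) :=
  (memLp_tensor n (Lp.memLp g) (Lp.memLp f)).toLp _

theorem norm_tensor {n : ℕ} (g : OneParticle) (f : Particles n) :
    ‖tensor g f‖ = ‖g‖ * ‖f‖ := by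
  rw [tensor, Lp.norm_toLp, eLpNorm_tensor n (Lp.memLp g).1 (Lp.memLp f).1, ENNReal.toReal_mul,
    ← Lp.norm_def, ← Lp.norm_def]

theorem coeFn_tensor {n : ℕ} (g : OneParticle) (f : Particles n) :
    tensor g f =ᵐ[orthant (n + 1)] fun x => g (x 0) * f (Fin.tail x) :=
  MemLp.coeFn_toLp _

theorem quasiMeasurePreserving_tail (n : ℕ) :
    Measure.QuasiMeasurePreserving (fun x : Fin (n + 1) → ℝ => Fin.tail x)
      (orthant (n + 1)) (orthant n) :=
  Measure.quasiMeasurePreserving_snd.comp (measurePreserving_headTail n).quasiMeasurePreserving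

theorem tensor_add {n : ℕ} (g : OneParticle) (f₁ f₂ : Particles n) :
    tensor g (f₁ + f₂) = tensor g f₁ + tensor g f₂ := by
  apply Lp.ext
  filter_upwards [coeFn_tensor g (f₁ + f₂), coeFn_tensor g f₁, coeFn_tensor g f₂,
    Lp.coeFn_add (tensor g f₁) (tensor g f₂),
    (quasiMeasurePreserving_tail n).ae (Lp.coeFn_add f₁ f₂)] with x h h₁ h₂ h₃ h₄
  rw [h, h₃, Pi.add_apply, h₁, h₂, h₄, Pi.add_apply, mul_add]

theorem tensor_smul {n : ℕ} (g : OneParticle) (c : ℂ) (f : Particles n) :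
    tensor g (c • f) = c • tensor g f := by
  apply Lp.ext
  filter_upwards [coeFn_tensor g (c • f), coeFn_tensor g f, Lp.coeFn_smul c (tensor g f),
    (quasiMeasurePreserving_tail n).ae (Lp.coeFn_smul c f)] with x h h₁ h₂ h₃
  rw [h, h₂, Pi.smul_apply, h₁, h₃, Pi.smul_apply, smul_eq_mul, smul_eq_mul, mul_left_comm]

/-- The components of `g ⊗ ξ` for a Fock space vector `ξ`. -/
def creationFun (g : OneParticle) (ξ : Fock) : ∀ n, Particles n
  | 0 => 0
  | n + 1 => tensor g (ξ n)

theorem hasSum_creationFun (g : OneParticle) (ξ : Fock) :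
    HasSum (fun n => ‖creationFun g ξ n‖ ^ (2 : ℝ≥0∞).toReal)
      ((‖g‖ * ‖ξ‖) ^ (2 : ℝ≥0∞).toReal) := by
  rw [hasSum_nat_add_iff' 1 |>.symm]
  have h := (lp.hasSum_norm (by norm_num : 0 < (2 : ℝ≥0∞).toReal) ξ).mul_left
    (‖g‖ ^ (2 : ℝ≥0∞).toReal)
  simpa [creationFun, norm_tensor, mul_pow] using h

/-- The left creation operator `a⁺(g) : f₁ ⊗ ⋯ ⊗ fₙ ↦ g ⊗ f₁ ⊗ ⋯ ⊗ fₙ`, `Ω ↦ g`. -/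
def creation (g : OneParticle) : Fock →L[ℂ] Fock :=
  LinearMap.mkContinuous
    { toFun := fun ξ => ⟨creationFun g ξ, memℓp_gen (hasSum_creationFun g ξ).summable⟩
      map_add' := by
        intro ξ η
        ext1
        funext n
        cases n with
        | zero => exact (add_zero (0 : Particles 0)).symm
        | succ n => exact tensor_add g (ξ n) (η n)
      map_smul' := by
        intro c ξ
        ext1
        funext n
        cases n with
        | zero => exact (smul_zero c).symm
        | succ n => exact tensor_smul g c (ξ n) }
    ‖g‖ (by
      intro ξ
      have h := (lp.hasSum_norm (by norm_num : 0 < (2 : ℝ≥0∞).toReal)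
        (⟨creationFun g ξ, memℓp_gen (hasSum_creationFun g ξ).summable⟩ : Fock)).unique
          (hasSum_creationFun g ξ)
      exact ((Real.rpow_left_inj (norm_nonneg _) (by positivity) (by norm_num)).1 h).le)

/-- The left annihilation operator `a⁻(g)`, the adjoint of `a⁺(g)`: it annihilates `Ω` and maps
`f₁ ⊗ f₂ ⊗ ⋯ ⊗ fₙ` to `⟨g, f₁⟩ f₂ ⊗ ⋯ ⊗ fₙ`. -/
def annihilation (g : OneParticle) : Fock →L[ℂ] Fock := ContinuousLinearMap.adjoint (creation g)

/-- The orthogonal projection of the Fock space onto the tensors of length at least one. -/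
def projNonvacuum : Fock →L[ℂ] Fock := 1 - (ℂ ∙ vacuum).starProjection

/-! ### The process -/

/-- The operator `X(g)`: `X(g) Ω = g`, and
`X(g) (f₁ ⊗ ⋯ ⊗ fₙ) = g ⊗ f₁ ⊗ ⋯ ⊗ fₙ + α ⟨g⟩ f₁ ⊗ ⋯ ⊗ fₙ + ⟨g, f₁⟩ f₂ ⊗ ⋯ ⊗ fₙ` for `n ≥ 1`,
where `⟨g⟩ = ∫ g`. It is used for (real-valued) integrable `g`. -/
def field (α : ℝ) (g : OneParticle) : Fock →L[ℂ] Fock :=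
  creation g + annihilation g + ((α : ℂ) * ∫ x, g x ∂halfLine) • projNonvacuum

theorem halfLine_Ico_ne_top (t : ℝ) : halfLine (Set.Ico 0 t) ≠ ∞ :=
  ((Measure.restrict_apply_le _ _).trans_lt measure_Ico_lt_top).ne

/-- `X(t) = X(1_{[0,t)})`. -/
def process (α t : ℝ) : Fock →L[ℂ] Fock :=
  field α (indicatorConstLp 2 measurableSet_Ico (halfLine_Ico_ne_top t) 1)

/-- `C_T = 1 + α X(T)`. -/
def correction (α T : ℝ) : Fock →L[ℂ] Fock := 1 + (α : ℂ) • process α T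

/-! ### Von Neumann algebras and states -/

section States

variable {H : Type*} [NormedAddCommGroup H] [InnerProductSpace ℂ H] [CompleteSpace H]

/-- The von Neumann algebra `W^*(S)` generated by a set `S` of bounded operators: the double
commutant of `S ∪ S^*`. -/
def generatedVN (S : Set (H →L[ℂ] H)) : VonNeumannAlgebra H where
  toStarSubalgebra := StarSubalgebra.centralizer ℂ (StarSubalgebra.centralizer ℂ S : Set _)
  centralizer_centralizer' := by
    change Set.centralizer (Set.centralizer (Set.centralizer _)) = Set.centralizer _
    exact Set.centralizer_centralizer_centralizer _

/-- The ultraweak (σ-weak) topology on `B(H)`: the coarsest topology for which all the functionals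
`A ↦ ∑ n, ⟨ξₙ, A ηₙ⟩` with `∑ ‖ξₙ‖² < ∞` and `∑ ‖ηₙ‖² < ∞` are continuous. -/
@[reducible]
def ultraweak : TopologicalSpace (H →L[ℂ] H) :=
  ⨅ (ξ : lp (fun _ : ℕ => H) 2) (η : lp (fun _ : ℕ => H) 2),
    TopologicalSpace.induced (fun A => ∑' n, ⟪ξ n, A (η n)⟫_ℂ) inferInstance

variable {M : VonNeumannAlgebra H}

/-- A state: a unital positive linear functional. -/
def IsState (f : M.toStarSubalgebra →ₗ[ℂ] ℂ) : Prop :=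
  f 1 = 1 ∧ ∀ a, 0 ≤ (f (star a * a)).re ∧ (f (star a * a)).im = 0

/-- A functional is normal if it is continuous for the ultraweak topology. -/
def IsNormal (f : M.toStarSubalgebra →ₗ[ℂ] ℂ) : Prop :=
  Continuous[TopologicalSpace.induced Subtype.val ultraweak, inferInstance] f

/-- A functional is faithful if it vanishes on no nonzero positive element `a^* a`. -/
def IsFaithful (f : M.toStarSubalgebra →ₗ[ℂ] ℂ) : Prop :=
  ∀ a, f (star a * a) = 0 → a = 0

/-- A functional is tracial if `f (a b) = f (b a)`. -/
def IsTracial (f : M.toStarSubalgebra →ₗ[ℂ] ℂ) : Prop :=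
  ∀ a b, f (a * b) = f (b * a)

end States

/-- `A_T = W^*(X(t) : 0 ≤ t ≤ T)`. -/
def processVN (α T : ℝ) : VonNeumannAlgebra Fock :=
  generatedVN {A | ∃ t ∈ Set.Icc 0 T, A = process α t}

/-- `φ[A] = ⟨Ω, A Ω⟩` on `A_T`. -/
def phi (α T : ℝ) : (processVN α T).toStarSubalgebra →ₗ[ℂ] ℂ where
  toFun A := ⟪vacuum, (A : Fock →L[ℂ] Fock) vacuum⟫_ℂ
  map_add' A B := by simp
  map_smul' c A := by simp

/-- `ψ_T[A] = φ[A C_T] = ⟨Ω, A C_T Ω⟩` on `A_T`. -/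
def psi (α T : ℝ) : (processVN α T).toStarSubalgebra →ₗ[ℂ] ℂ where
  toFun A := ⟪vacuum, ((A : Fock →L[ℂ] Fock) * correction α T) vacuum⟫_ℂ
  map_add' A B := by simp
  map_smul' c A := by simp

end TwoStateFree

end

noncomputable section

namespace TwoStateFree

/-! ### Tensors of square integrable functions -/

/-! Put `e = α 1_[0,T)`, a unit vector since `α² T = 1`, and let `h` be a unit vector orthogonal to
every `1_[0,t)` with `t ≤ T`. Write `a±` and `r±` for left and right creation and annihilation, and
`P` for the vacuum projection. The generators are `X = a⁺(g) + a⁻(g) + c (1 - P)` with `c = ⟨e, g⟩`.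
The defect `-cP` separates them from shifted semicircular operators `s = a⁺(g) + a⁻(g) + c`, but `X
r⁺(h) = r⁺(h) s` and `(1 + r⁻(e)) X = s (1 + r⁻(e))` (`fieldOp_mul_rightCreation`,
`one_add_rightAnnihilation_mul_fieldOp`). So the commutant contains `r⁺(h) (1 + r⁻(e))`, its
adjoint, and all `r⁺(h) R r⁻(h)` with `R` a right semicircular operator for an indicator.

Since `C_T Ω = Ω + e`, the adjoint intertwiner turns `ψ_T` into the vector state of `h`
(`inner_rightCreation_vacuum`). On `h` each generator agrees with a self-adjoint commutant element
plus a real scalar, so this state is tracial against generators, and `inner_mul_comm_of_generators`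
extends this to the whole algebra.

For faithfulness, `A h = 0` gives `A r⁺(h) = 0` by cyclicity of `Ω` for the operators `R`. The
adjoint intertwiner then gives `A (1 + r⁺(e)) = 0`, and `1 + r⁻(e)` is injective because `‖e‖ ≤ 1`,
so `A = 0`. Finally `A Ω = 0` forces `A h = 0` through the intertwiner, which settles `φ`. -/

theorem integrable_setIntegral_prod_eq_zero {X Y : Type*} [MeasurableSpace X] [MeasurableSpace Y]
    {μ : Measure X} {ν : Measure Y} {s : Set X} {t : Set Y} (hs : MeasurableSet s)
    (ht : MeasurableSet t) {F : X × Y → ℂ} (hF : IntegrableOn F (s ×ˢ t) (μ.prod ν))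
    (h : ∀ a ⊆ s, ∀ b ⊆ t, MeasurableSet a → MeasurableSet b →
      ∫ z in a ×ˢ b, F z ∂μ.prod ν = 0) :
    F =ᵐ[(μ.prod ν).restrict (s ×ˢ t)] 0 := by
  have huniv : ∫ z in s ×ˢ t, F z ∂μ.prod ν = 0 := h s subset_rfl t subset_rfl hs ht
  refine Integrable.ae_eq_zero_of_forall_setIntegral_eq_zero hF fun E hE hE' => ?_
  -- Finiteness of the measure of `E` must not enter the induction hypothesis, which has to range
  -- over all measurable sets.
  clear hE'
  induction E, hE using MeasurableSpace.induction_on_inter generateFrom_prod.symm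
    isPiSystem_prod with
  | empty => simp
  | basic E hE =>
    obtain ⟨a, ha, b, hb, rfl⟩ := hE
    rw [Measure.restrict_restrict (MeasurableSet.prod ha hb), Set.prod_inter_prod]
    exact h _ Set.inter_subset_right _ Set.inter_subset_right (MeasurableSet.inter ha hs)
      (MeasurableSet.inter hb ht)
  | compl E hE ih =>
    have := integral_add_compl hE hF
    rw [huniv] at this
    rwa [ih, zero_add] at this
  | iUnion E hd hE ih =>
    rw [integral_iUnion hE hd hF.integrableOn]
    simp [ih]

/-- Countably many rectangles of finite measure exhaust the product, and a square integrable
function is integrable on each. -/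
theorem memLp_ae_eq_zero_of_setIntegral_prod {X Y : Type*} [MeasurableSpace X] [MeasurableSpace Y]
    {μ : Measure X} {ν : Measure Y} [SigmaFinite μ] [SigmaFinite ν] {F : X × Y → ℂ}
    (hF : MemLp F 2 (μ.prod ν))
    (h : ∀ a b, MeasurableSet a → MeasurableSet b → μ a ≠ ∞ → ν b ≠ ∞ →
      ∫ z in a ×ˢ b, F z ∂μ.prod ν = 0) :
    F =ᵐ[μ.prod ν] 0 := by
  have hU : (⋃ p : ℕ × ℕ, spanningSets μ p.1 ×ˢ spanningSets ν p.2) = Set.univ := by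
    rw [Set.iUnion_prod', Set.eq_univ_iff_forall]
    intro z
    simp only [Set.mem_iUnion, Set.mem_prod]
    exact ⟨_, _, mem_spanningSetsIndex μ z.1, mem_spanningSetsIndex ν z.2⟩
  rw [← Measure.restrict_univ (μ := μ.prod ν), ← hU]
  refine (ae_restrict_iUnion_iff _ _).2 fun p => ?_
  have hs := measure_spanningSets_lt_top μ p.1
  have ht := measure_spanningSets_lt_top ν p.2
  refine integrable_setIntegral_prod_eq_zero (measurableSet_spanningSets μ p.1)
    (measurableSet_spanningSets ν p.2) ?_ fun a ha b hb hma hmb =>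
      h a b hma hmb ((measure_mono ha).trans_lt hs).ne ((measure_mono hb).trans_lt ht).ne
  have : IsFiniteMeasure ((μ.prod ν).restrict (spanningSets μ p.1 ×ˢ spanningSets ν p.2)) := by
    refine ⟨?_⟩
    rw [Measure.restrict_apply_univ, Measure.prod_prod]
    exact ENNReal.mul_lt_top hs ht
  exact (hF.restrict _).integrable one_le_two

theorem inner_tensor {n : ℕ} (g g' : OneParticle) (f f' : Particles n) :
    ⟪tensor g f, tensor g' f'⟫_ℂ = ⟪g, g'⟫_ℂ * ⟪f, f'⟫_ℂ := by
  rw [L2.inner_def, L2.inner_def, L2.inner_def, ← integral_prod_mul,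
    ← (measurePreserving_headTail n).integral_comp
      (MeasurableEquiv.piFinSuccAbove (fun _ : Fin (n + 1) => ℝ) 0).measurableEmbedding]
  refine integral_congr_ae ?_
  filter_upwards [coeFn_tensor g f, coeFn_tensor g' f'] with x h h'
  rw [h, h']
  simp only [RCLike.inner_apply, map_mul]
  ring

/-- Taking `ζ` to be an indicator as well turns the inner products into integrals over rectangles.
-/
theorem eq_zero_of_inner_tensor_indicator {n : ℕ} (ξ : Particles (n + 1))
    (h : ∀ (s : Set ℝ) (hs : MeasurableSet s) (hs' : halfLine s ≠ ∞) (ζ : Particles n),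
      ⟪tensor (indicatorConstLp 2 hs hs' 1) ζ, ξ⟫_ℂ = 0) : ξ = 0 := by
  set e := MeasurableEquiv.piFinSuccAbove (fun _ : Fin (n + 1) => ℝ) 0
  have he : MeasurePreserving e (orthant (n + 1)) (halfLine.prod (orthant n)) :=
    measurePreserving_headTail n
  have hF : MemLp (ξ ∘ e.symm) 2 (halfLine.prod (orthant n)) :=
    (Lp.memLp ξ).comp_measurePreserving (he.symm e)
  have h0 : ξ ∘ e.symm =ᵐ[halfLine.prod (orthant n)] 0 := by
    refine memLp_ae_eq_zero_of_setIntegral_prod hF fun a b ha hb ha' hb' => ?_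
    rw [← h a ha ha' (indicatorConstLp 2 hb hb' 1), L2.inner_def,
      ← integral_indicator (ha.prod hb), ← he.integral_comp e.measurableEmbedding]
    refine integral_congr_ae ?_
    have h1 := (Measure.quasiMeasurePreserving_fst.comp he.quasiMeasurePreserving).ae
      (indicatorConstLp_coeFn (p := 2) (hs := ha) (hμs := ha') (c := (1 : ℂ)))
    filter_upwards [coeFn_tensor (indicatorConstLp 2 ha ha' 1) (indicatorConstLp 2 hb hb' 1),
      h1, (quasiMeasurePreserving_tail n).ae
        (indicatorConstLp_coeFn (p := 2) (hs := hb) (hμs := hb') (c := (1 : ℂ)))] with x hx h1 h2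
    have h1' : (indicatorConstLp 2 ha ha' (1 : ℂ)) (x 0) = a.indicator (fun _ => 1) (x 0) := h1
    have hex : e x = (x 0, Fin.tail x) := rfl
    rw [hx, h1', h2]
    have hξ : (ξ ∘ e.symm) (e x) = ξ x := congrArg ξ (e.symm_apply_apply x)
    rw [Set.indicator, hξ, hex]
    by_cases hA : x 0 ∈ a <;> by_cases hB : Fin.tail x ∈ b <;> simp [hA, hB, Set.mem_prod]
  apply Lp.ext
  filter_upwards [he.quasiMeasurePreserving.ae h0, Lp.coeFn_zero ℂ 2 (orthant (n + 1))] with x h1 h2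
  rw [h2]
  simpa using h1

/-! ### Reversing the order of the tensor factors -/

theorem measurePreserving_rev (n : ℕ) :
    MeasurePreserving (fun x : Fin n → ℝ => x ∘ Fin.rev) (orthant n) (orthant n) := by
  have h := measurePreserving_piCongrLeft (fun _ : Fin n => halfLine) Fin.revPerm
  unfold orthant
  convert h using 1
  ext x i
  have := MeasurableEquiv.piCongrLeft_apply_apply Fin.revPerm (β := fun _ : Fin n => ℝ) x (Fin.rev i)
  simpa using this.symm

/-- Reversal of the order of the factors on `L²(ℝ₊)^{⊗ n}`. -/
def rev (n : ℕ) : Particles n →ₗᵢ[ℂ] Particles n :=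
  Lp.compMeasurePreservingₗᵢ ℂ _ (measurePreserving_rev n)

theorem coeFn_rev {n : ℕ} (f : Particles n) : rev n f =ᵐ[orthant n] fun x => f (x ∘ Fin.rev) :=
  Lp.coeFn_compMeasurePreserving f (measurePreserving_rev n)

theorem rev_rev {n : ℕ} (f : Particles n) : rev n (rev n f) = f := by
  apply Lp.ext
  filter_upwards [coeFn_rev (rev n f), (measurePreserving_rev n).quasiMeasurePreserving.ae
    (coeFn_rev f)] with x h1 h2
  rw [h1, h2]
  congr 1
  ext i
  simp

theorem rev_of_le_one {n : ℕ} (hn : n ≤ 1) (f : Particles n) : rev n f = f := by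
  have := Fin.subsingleton_iff_le_one.2 hn
  apply Lp.ext
  filter_upwards [coeFn_rev f] with x h1
  rw [h1]
  congr 1
  ext i
  exact congrArg x (Subsingleton.elim _ _)

/-- Both sides are `g ⊗ f ⊗ h`: conjugating by reversal moves the new factor to the right end. -/
theorem rev_tensor_rev_tensor {n : ℕ} (g h : OneParticle) (f : Particles n) :
    rev (n + 2) (tensor h (rev (n + 1) (tensor g f))) =
      tensor g (rev (n + 1) (tensor h (rev n f))) := by
  have qr (m : ℕ) := (measurePreserving_rev m).quasiMeasurePreserving
  have qt := quasiMeasurePreserving_tail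
  apply Lp.ext
  filter_upwards [coeFn_rev (tensor h (rev (n + 1) (tensor g f))),
    (qr _).ae (coeFn_tensor h (rev (n + 1) (tensor g f))),
    (qr _).ae ((qt _).ae (coeFn_rev (tensor g f))),
    (qr _).ae ((qt _).ae ((qr _).ae (coeFn_tensor g f))),
    coeFn_tensor g (rev (n + 1) (tensor h (rev n f))),
    (qt _).ae (coeFn_rev (tensor h (rev n f))),
    (qt _).ae ((qr _).ae (coeFn_tensor h (rev n f))),
    (qt _).ae ((qr _).ae ((qt _).ae (coeFn_rev f)))] with x h1 h2 h3 h4 h5 h6 h7 h8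
  rw [h1, h2, h3, h4, h5, h6, h7, h8]
  have e0 : (Fin.tail (x ∘ Fin.rev) ∘ Fin.rev) 0 = x 0 := by
    simp [Fin.tail, Fin.rev_zero]
  have e1 : (x ∘ Fin.rev) 0 = (Fin.tail x ∘ Fin.rev) 0 := by
    simp [Fin.tail, Fin.rev_zero]
  have e2 : Fin.tail (Fin.tail (x ∘ Fin.rev) ∘ Fin.rev) =
      Fin.tail (Fin.tail x ∘ Fin.rev) ∘ Fin.rev := by
    ext i
    simp [Fin.tail, Fin.rev_succ, Fin.rev_castSucc]
  rw [e0, e1, e2]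
  ring

/-! ### Vectors and operators on the Fock space -/

theorem creation_apply_succ (g : OneParticle) (ξ : Fock) (n : ℕ) :
    creation g ξ (n + 1) = tensor g (ξ n) := rfl

theorem creation_apply_zero (g : OneParticle) (ξ : Fock) : creation g ξ 0 = 0 := rfl

theorem exists_eq_smul_one (f : Particles 0) :
    ∃ c : ℂ, f = c • memLp_one_orthant_zero.toLp _ := by
  refine ⟨f 0, Lp.ext ?_⟩
  filter_upwards [Lp.coeFn_smul (f 0) (memLp_one_orthant_zero.toLp _),
    memLp_one_orthant_zero.coeFn_toLp] with x h1 h2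
  rw [h1, Pi.smul_apply, h2, smul_eq_mul, mul_one, Subsingleton.elim x 0]

theorem norm_vacuum : ‖vacuum‖ = 1 := by
  rw [vacuum, lp.norm_single (by norm_num), Lp.norm_toLp]
  have : orthant 0 = Measure.dirac default := by
    unfold orthant
    rw [Measure.pi_of_empty]
    congr 1
    exact Subsingleton.elim _ _
  rw [this, eLpNorm_const _ (by norm_num) (by simp)]
  simp

theorem inner_vacuum_vacuum : ⟪vacuum, vacuum⟫_ℂ = 1 := by
  rw [inner_self_eq_norm_sq_to_K, norm_vacuum]
  simp

theorem apply_zero_eq_zero {ξ : Fock} (h : ⟪vacuum, ξ⟫_ℂ = 0) : ξ 0 = 0 := by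
  rw [vacuum, lp.inner_single_left] at h
  obtain ⟨c, hc⟩ := exists_eq_smul_one (ξ 0)
  rw [← inner_self_eq_zero (𝕜 := ℂ)]
  nth_rw 1 [hc]
  rw [inner_smul_left, h, mul_zero]

theorem creation_single (g : OneParticle) {n : ℕ} (f : Particles n) :
    creation g (lp.single 2 n f) = lp.single 2 (n + 1) (tensor g f) := by
  ext1
  funext m
  rcases m with _ | m
  · rw [creation_apply_zero, lp.single_apply_ne _ _ _ (by omega)]
  · rw [creation_apply_succ]
    by_cases hm : m = n
    · subst hm
      rw [lp.single_apply_self, lp.single_apply_self]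
    · rw [lp.single_apply_ne _ _ _ hm, lp.single_apply_ne _ _ _ (by omega)]
      simpa using tensor_smul g 0 (0 : Particles m)

theorem inner_creation_creation (g g' : OneParticle) (ξ η : Fock) :
    ⟪creation g ξ, creation g' η⟫_ℂ = ⟪g, g'⟫_ℂ * ⟪ξ, η⟫_ℂ := by
  have h : Summable fun n => ⟪creation g ξ n, creation g' η n⟫_ℂ := lp.summable_inner _ _
  rw [lp.inner_eq_tsum, lp.inner_eq_tsum, h.tsum_eq_zero_add,
    creation_apply_zero, inner_zero_left, zero_add, ← tsum_mul_left]
  exact tsum_congr fun n => inner_tensor g g' (ξ n) (η n)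

theorem inner_annihilation_right (g : OneParticle) (ξ η : Fock) :
    ⟪ξ, annihilation g η⟫_ℂ = ⟪creation g ξ, η⟫_ℂ :=
  ContinuousLinearMap.adjoint_inner_right _ _ _

theorem star_creation (g : OneParticle) : star (creation g) = annihilation g := rfl

theorem star_annihilation (g : OneParticle) : star (annihilation g) = creation g :=
  star_star (creation g)

theorem annihilation_mul_creation (g g' : OneParticle) :
    annihilation g * creation g' = ⟪g, g'⟫_ℂ • 1 := by
  ext1 ξ
  refine ext_inner_left ℂ fun ζ => ?_
  simp [inner_annihilation_right, inner_creation_creation, inner_smul_right]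

/-- Pair the component with itself, move `a⁻(g)` across as a tensor with `g`, and apply
Cauchy–Schwarz. -/
theorem norm_annihilation_apply_le (g : OneParticle) (ξ : Fock) (n : ℕ) :
    ‖annihilation g ξ n‖ ≤ ‖g‖ * ‖ξ (n + 1)‖ := by
  set ζ := annihilation g ξ n
  have h : ⟪ζ, ζ⟫_ℂ = ⟪tensor g ζ, ξ (n + 1)⟫_ℂ := by
    rw [← lp.inner_single_left (G := Particles), inner_annihilation_right, creation_single,
      lp.inner_single_left]
  have h2 : ‖ζ‖ * ‖ζ‖ ≤ ‖ζ‖ * (‖g‖ * ‖ξ (n + 1)‖) := by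
    have h1 : ‖ζ‖ * ‖ζ‖ = ‖⟪ζ, ζ⟫_ℂ‖ := by
      rw [inner_self_eq_norm_sq_to_K, ← pow_two]
      simp
    rw [h1, h]
    refine (norm_inner_le_norm _ _).trans_eq ?_
    rw [norm_tensor]
    ring
  by_cases h0 : ‖ζ‖ = 0
  · rw [h0]; positivity
  · exact le_of_mul_le_mul_left h2 (lt_of_le_of_ne (norm_nonneg _) (Ne.symm h0))

theorem annihilation_vacuum (g : OneParticle) : annihilation g vacuum = 0 := by
  ext1
  funext n
  rw [lp.coeFn_zero, Pi.zero_apply, ← norm_le_zero_iff]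
  refine (norm_annihilation_apply_le g vacuum n).trans_eq ?_
  rw [vacuum, lp.single_apply_ne _ _ _ (by omega)]
  simp

theorem exists_annihilation_single (g : OneParticle) {n : ℕ} (f : Particles (n + 1)) :
    ∃ f' : Particles n, annihilation g (lp.single 2 (n + 1) f) = lp.single 2 n f' := by
  refine ⟨annihilation g (lp.single 2 (n + 1) f) n, ?_⟩
  ext1
  funext m
  by_cases hm : m = n
  · subst hm
    rw [lp.single_apply_self]
  · rw [lp.single_apply_ne _ _ _ hm, ← norm_le_zero_iff]
    refine (norm_annihilation_apply_le g _ m).trans_eq ?_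
    rw [lp.single_apply_ne _ _ _ (by omega)]
    simp

/-- The equation makes the norms of the components nondecreasing in `n`, while their squares are
summable. -/
theorem eq_zero_of_annihilation_eq_neg {g : OneParticle} (hg : ‖g‖ ≤ 1) {ξ : Fock}
    (h : annihilation g ξ = -ξ) : ξ = 0 := by
  have hmono : Monotone fun n => ‖ξ n‖ := monotone_nat_of_le_succ fun n => by
    have := norm_annihilation_apply_le g ξ n
    rw [h, lp.coeFn_neg, Pi.neg_apply, norm_neg] at this
    exact this.trans (mul_le_of_le_one_left (norm_nonneg _) hg)
  have hlim : Filter.Tendsto (fun n => ‖ξ n‖) Filter.atTop (𝓝 0) := by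
    have := (lp.hasSum_norm (by norm_num : 0 < (2 : ℝ≥0∞).toReal) ξ).summable.tendsto_atTop_zero
    have := this.sqrt
    simpa [Real.sqrt_sq] using this
  ext1
  funext n
  rw [lp.coeFn_zero, Pi.zero_apply, ← norm_le_zero_iff]
  exact hmono.ge_of_tendsto hlim n

theorem eq_zero_of_inner_creation {ξ : Fock} (h0 : ⟪vacuum, ξ⟫_ℂ = 0)
    (h : ∀ (s : Set ℝ) (hs : MeasurableSet s) (hs' : halfLine s ≠ ∞) (n : ℕ) (ζ : Particles n),
      ⟪creation (indicatorConstLp 2 hs hs' 1) (lp.single 2 n ζ), ξ⟫_ℂ = 0) : ξ = 0 := by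
  ext1
  funext n
  rcases n with _ | n
  · exact apply_zero_eq_zero h0
  · refine eq_zero_of_inner_tensor_indicator _ fun s hs hs' ζ => ?_
    rw [← lp.inner_single_left (G := Particles), ← creation_single]
    exact h s hs hs' n ζ

/-- The vacuum is cyclic for the operators `a⁺(f) + a⁻(f)`, `f` an indicator function. -/
theorem eq_top_of_vacuum_mem (Z : Submodule ℂ Fock) (hZ : IsClosed (Z : Set Fock))
    (hvac : vacuum ∈ Z)
    (h : ∀ (s : Set ℝ) (hs : MeasurableSet s) (hs' : halfLine s ≠ ∞), ∀ ζ ∈ Z,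
      (creation (indicatorConstLp 2 hs hs' 1) + annihilation (indicatorConstLp 2 hs hs' 1)) ζ ∈ Z) :
    Z = ⊤ := by
  have : CompleteSpace Z := hZ.completeSpace_coe
  -- Since `a⁺ = (a⁺ + a⁻) - a⁻`, knowing that `Z` contains the `a⁻` part gives all `1_s ⊗ ζ`; these
  -- are total in the next level.
  have hcre (n : ℕ) (hn : ∀ f : Particles n, lp.single 2 n f ∈ Z)
      (hn' : ∀ g (f : Particles n), annihilation g (lp.single 2 n f) ∈ Z) :
      ∀ f : Particles (n + 1), lp.single 2 (n + 1) f ∈ Z := by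
    let W := Z.comap (lp.singleContinuousLinearMap ℂ Particles 2 (n + 1)).toLinearMap
    have hW : IsClosed (W : Set (Particles (n + 1))) :=
      hZ.preimage (lp.singleContinuousLinearMap ℂ Particles 2 (n + 1)).continuous
    have : CompleteSpace W := hW.completeSpace_coe
    suffices W = ⊤ from fun f => (this ▸ Submodule.mem_top : f ∈ W)
    rw [← Submodule.orthogonal_eq_bot_iff, Submodule.eq_bot_iff]
    refine fun ξ hξ => eq_zero_of_inner_tensor_indicator ξ fun s hs hs' ζ => hξ _ ?_
    change lp.single 2 (n + 1) _ ∈ Z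
    rw [← creation_single]
    have := Z.sub_mem (h s hs hs' _ (hn ζ)) (hn' (indicatorConstLp 2 hs hs' 1) ζ)
    rwa [add_apply, add_sub_cancel_right] at this
  have hsingle (n : ℕ) : (∀ f : Particles n, lp.single 2 n f ∈ Z) ∧
      ∀ g (f : Particles n), annihilation g (lp.single 2 n f) ∈ Z := by
    induction n with
    | zero =>
      have h0 (f : Particles 0) : ∃ c : ℂ, (lp.single 2 0 f : Fock) = c • vacuum := by
        obtain ⟨c, rfl⟩ := exists_eq_smul_one f
        exact ⟨c, lp.single_smul _ _ _ _⟩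
      refine ⟨fun f => ?_, fun g f => ?_⟩ <;> obtain ⟨c, hc⟩ := h0 f <;> rw [hc]
      · exact Z.smul_mem c hvac
      · rw [map_smul, annihilation_vacuum, smul_zero]
        exact Z.zero_mem
    | succ n ih =>
      refine ⟨hcre n ih.1 ih.2, fun g f => ?_⟩
      obtain ⟨f', hf'⟩ := exists_annihilation_single g f
      rw [hf']
      exact ih.1 f'
  rw [← Submodule.orthogonal_eq_bot_iff, Submodule.eq_bot_iff]
  intro ξ hξ
  ext1
  funext n
  have := hξ _ ((hsingle n).1 (ξ n))
  rw [lp.inner_single_left] at this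
  exact inner_self_eq_zero.1 this

/-- The vacuum and the ranges of the creation operators are total, so `(A - B)^*` maps every vector
to one orthogonal to everything. -/
theorem ext_creation {A B : Fock →L[ℂ] Fock} (h0 : A vacuum = B vacuum)
    (h : ∀ g ξ, A (creation g ξ) = B (creation g ξ)) : A = B := by
  rw [← sub_eq_zero, ← star_eq_zero]
  ext1 ξ
  refine eq_zero_of_inner_creation ?_ fun s hs hs' n ζ => ?_
  · rw [ContinuousLinearMap.star_eq_adjoint, ContinuousLinearMap.adjoint_inner_right]
    simp [h0]
  · rw [ContinuousLinearMap.star_eq_adjoint, ContinuousLinearMap.adjoint_inner_right]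
    simp [h]

/-! ### Right creation and annihilation operators -/

theorem hasSum_norm_rev (ξ : Fock) :
    HasSum (fun n => ‖rev n (ξ n)‖ ^ (2 : ℝ≥0∞).toReal) (‖ξ‖ ^ (2 : ℝ≥0∞).toReal) := by
  simpa only [LinearIsometry.norm_map] using
    lp.hasSum_norm (by norm_num : 0 < (2 : ℝ≥0∞).toReal) ξ

/-- Reversal of the order of the factors of all tensors in the Fock space. -/
def flip : Fock →ₗᵢ[ℂ] Fock where
  toFun ξ := ⟨fun n => rev n (ξ n), memℓp_gen (hasSum_norm_rev ξ).summable⟩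
  map_add' ξ η := by
    ext1
    funext n
    exact map_add (rev n) (ξ n) (η n)
  map_smul' c ξ := by
    ext1
    funext n
    exact map_smul (rev n) c (ξ n)
  norm_map' ξ := by
    have h := (lp.hasSum_norm (by norm_num : 0 < (2 : ℝ≥0∞).toReal)
      (⟨fun n => rev n (ξ n), memℓp_gen (hasSum_norm_rev ξ).summable⟩ : Fock)).unique
        (hasSum_norm_rev ξ)
    exact (Real.rpow_left_inj (norm_nonneg _) (norm_nonneg _) (by norm_num)).1 h

theorem flip_apply (ξ : Fock) (n : ℕ) : flip ξ n = rev n (ξ n) := rfl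

theorem flip_flip (ξ : Fock) : flip (flip ξ) = ξ := by
  ext1
  funext n
  rw [flip_apply, flip_apply, rev_rev]

theorem flip_vacuum : flip vacuum = vacuum := by
  ext1
  funext n
  rw [flip_apply]
  rcases n with _ | n
  · exact rev_of_le_one zero_le_one _
  · rw [vacuum, lp.single_apply_ne _ _ _ (by omega), map_zero]

theorem inner_flip_left (ξ η : Fock) : ⟪flip ξ, η⟫_ℂ = ⟪ξ, flip η⟫_ℂ := by
  rw [← flip.inner_map_map ξ (flip η), flip_flip]

theorem flip_creation_vacuum (g : OneParticle) :
    flip (creation g vacuum) = creation g vacuum := by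
  ext1
  funext n
  rw [flip_apply]
  rcases n with _ | _ | n
  · exact rev_of_le_one zero_le_one _
  · exact rev_of_le_one le_rfl _
  · rw [vacuum, creation_single, lp.single_apply_ne _ _ _ (by omega), map_zero]

/-- The right creation operator `r⁺(h) : f₁ ⊗ ⋯ ⊗ fₙ ↦ f₁ ⊗ ⋯ ⊗ fₙ ⊗ h`. -/
def rightCreation (h : OneParticle) : Fock →L[ℂ] Fock :=
  flip.toContinuousLinearMap * creation h * flip.toContinuousLinearMap

/-- The right annihilation operator, the adjoint of `r⁺(h)`. -/
def rightAnnihilation (h : OneParticle) : Fock →L[ℂ] Fock := star (rightCreation h)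

theorem rightCreation_apply (h : OneParticle) (ξ : Fock) :
    rightCreation h ξ = flip (creation h (flip ξ)) := rfl

theorem inner_rightAnnihilation_right (h : OneParticle) (ξ η : Fock) :
    ⟪ξ, rightAnnihilation h η⟫_ℂ = ⟪rightCreation h ξ, η⟫_ℂ :=
  ContinuousLinearMap.adjoint_inner_right _ _ _

theorem rightAnnihilation_apply (h : OneParticle) (ξ : Fock) :
    rightAnnihilation h ξ = flip (annihilation h (flip ξ)) := by
  refine ext_inner_left ℂ fun ζ => ?_
  rw [inner_rightAnnihilation_right, rightCreation_apply, inner_flip_left,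
    ← inner_annihilation_right, inner_flip_left]

theorem star_rightCreation (h : OneParticle) :
    star (rightCreation h) = rightAnnihilation h := rfl

theorem star_rightAnnihilation (h : OneParticle) :
    star (rightAnnihilation h) = rightCreation h := star_star _

theorem rightCreation_vacuum (h : OneParticle) :
    rightCreation h vacuum = creation h vacuum := by
  rw [rightCreation_apply, flip_vacuum, flip_creation_vacuum]

theorem rightAnnihilation_vacuum (h : OneParticle) : rightAnnihilation h vacuum = 0 := by
  rw [rightAnnihilation_apply, flip_vacuum, annihilation_vacuum, map_zero]

theorem creation_mul_rightCreation (g h : OneParticle) :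
    creation g * rightCreation h = rightCreation h * creation g := by
  ext1 ξ
  ext1
  funext n
  rcases n with _ | _ | n
  · exact ((rev_of_le_one zero_le_one _).trans rfl).symm
  · have h0 (k : OneParticle) : tensor k (0 : Particles 0) = 0 := by
      simpa using tensor_smul k 0 (0 : Particles 0)
    change tensor g (rev 0 0) = rev 1 (tensor h (rev 0 0))
    rw [map_zero, h0, h0, map_zero]
  · exact (rev_tensor_rev_tensor g h (ξ n)).symm

theorem annihilation_mul_rightAnnihilation (g h : OneParticle) :
    annihilation g * rightAnnihilation h = rightAnnihilation h * annihilation g := by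
  rw [← star_creation, ← star_rightCreation, ← star_mul, ← star_mul, creation_mul_rightCreation]

theorem rightAnnihilation_mul_rightCreation (g g' : OneParticle) :
    rightAnnihilation g * rightCreation g' = ⟪g, g'⟫_ℂ • 1 := by
  ext1 ξ
  have := congrArg (fun A : Fock →L[ℂ] Fock => flip (A (flip ξ))) (annihilation_mul_creation g g')
  simpa [rightAnnihilation_apply, rightCreation_apply, flip_flip] using this

/-! ### Commutation relations between left and right operators -/

/-- The orthogonal projection onto the vacuum. -/
def projVacuum : Fock →L[ℂ] Fock := (ℂ ∙ vacuum).starProjection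

theorem projVacuum_apply (ξ : Fock) : projVacuum ξ = ⟪vacuum, ξ⟫_ℂ • vacuum :=
  Submodule.starProjection_unit_singleton ℂ norm_vacuum ξ

theorem projVacuum_vacuum : projVacuum vacuum = vacuum := by
  rw [projVacuum_apply, inner_vacuum_vacuum, one_smul]

theorem star_projVacuum : star projVacuum = projVacuum :=
  (isStarProjection_starProjection (U := ℂ ∙ vacuum)).isSelfAdjoint

theorem annihilation_mul_projVacuum (g : OneParticle) : annihilation g * projVacuum = 0 := by
  ext1 ξ
  simp [projVacuum_apply, annihilation_vacuum]

theorem rightAnnihilation_mul_projVacuum (g : OneParticle) :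
    rightAnnihilation g * projVacuum = 0 := by
  ext1 ξ
  simp [projVacuum_apply, rightAnnihilation_vacuum]

theorem projVacuum_mul_creation (g : OneParticle) : projVacuum * creation g = 0 := by
  rw [← star_inj, star_mul, star_projVacuum, star_creation, annihilation_mul_projVacuum, star_zero]

theorem projVacuum_mul_rightCreation (g : OneParticle) : projVacuum * rightCreation g = 0 := by
  rw [← star_inj, star_mul, star_projVacuum, star_rightCreation, rightAnnihilation_mul_projVacuum,
    star_zero]

/-- The two operators act at opposite ends of a tensor and interfere only on the vacuum, where
`a⁻(g)` removes the `h` just created. -/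
theorem annihilation_mul_rightCreation (g h : OneParticle) :
    annihilation g * rightCreation h = rightCreation h * annihilation g + ⟪g, h⟫_ℂ • projVacuum := by
  have hac (g' : OneParticle) (ξ : Fock) : annihilation g (creation g' ξ) = ⟪g, g'⟫_ℂ • ξ :=
    congrArg (fun A : Fock →L[ℂ] Fock => A ξ) (annihilation_mul_creation g g')
  refine ext_creation ?_ fun g' ξ => ?_
  · simp [rightCreation_vacuum, annihilation_vacuum, projVacuum_vacuum, hac]
  · have h1 : rightCreation h (creation g' ξ) = creation g' (rightCreation h ξ) :=
      congrArg (fun A : Fock →L[ℂ] Fock => A ξ) (creation_mul_rightCreation g' h).symm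
    have h2 : projVacuum (creation g' ξ) = 0 :=
      congrArg (fun A : Fock →L[ℂ] Fock => A ξ) (projVacuum_mul_creation g')
    simp [h1, h2, hac]

theorem rightAnnihilation_mul_creation (g h : OneParticle) :
    rightAnnihilation h * creation g = creation g * rightAnnihilation h + ⟪h, g⟫_ℂ • projVacuum := by
  have := congrArg star (annihilation_mul_rightCreation g h)
  simpa [star_creation, star_annihilation, star_rightCreation, star_projVacuum] using this

theorem eq_top_of_vacuum_mem_right (Z : Submodule ℂ Fock) (hZ : IsClosed (Z : Set Fock))
    (hvac : vacuum ∈ Z)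
    (h : ∀ (s : Set ℝ) (hs : MeasurableSet s) (hs' : halfLine s ≠ ∞), ∀ ζ ∈ Z,
      (rightCreation (indicatorConstLp 2 hs hs' 1) +
        rightAnnihilation (indicatorConstLp 2 hs hs' 1)) ζ ∈ Z) :
    Z = ⊤ := by
  have := eq_top_of_vacuum_mem (Z.comap flip.toLinearMap) (hZ.preimage flip.continuous)
    (by simpa [flip_vacuum] using hvac) fun s hs hs' ζ hζ => by
      have := h s hs hs' (flip ζ) hζ
      simpa [rightCreation_apply, rightAnnihilation_apply, flip_flip] using this
  rw [Submodule.eq_top_iff'] at this ⊢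
  intro ξ
  simpa [flip_flip] using this (flip ξ)

theorem eq_zero_of_rightAnnihilation_eq_neg {g : OneParticle} (hg : ‖g‖ ≤ 1) {ξ : Fock}
    (h : rightAnnihilation g ξ = -ξ) : ξ = 0 := by
  have h1 : annihilation g (flip ξ) = -flip ξ := by
    rw [← map_neg, ← h, rightAnnihilation_apply, flip_flip]
  rw [← flip_flip ξ, eq_zero_of_annihilation_eq_neg hg h1, map_zero]

/-! ### Von Neumann algebras generated by self-adjoint operators -/

section Generated

variable {H : Type*} [NormedAddCommGroup H] [InnerProductSpace ℂ H] [CompleteSpace H]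

theorem subset_generatedVN (S : Set (H →L[ℂ] H)) :
    S ⊆ (generatedVN S).toStarSubalgebra := by
  intro X hX
  refine StarSubalgebra.mem_centralizer_iff ℂ |>.2 fun Y hY => ?_
  have hY' := star_mem hY
  exact ⟨((StarSubalgebra.mem_centralizer_iff ℂ).1 hY X hX).1.symm,
    ((StarSubalgebra.mem_centralizer_iff ℂ).1 hY' X hX).1.symm⟩

theorem mul_comm_of_mem_generatedVN {S : Set (H →L[ℂ] H)} (hS : ∀ X ∈ S, star X = X)
    {A Y : H →L[ℂ] H} (hA : A ∈ (generatedVN S).toStarSubalgebra)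
    (hY : ∀ X ∈ S, X * Y = Y * X) : A * Y = Y * A := by
  have hY' : Y ∈ StarSubalgebra.centralizer ℂ S :=
    (StarSubalgebra.mem_centralizer_iff ℂ).2 fun X hX => ⟨hY X hX, by rw [hS X hX, hY X hX]⟩
  exact (((StarSubalgebra.mem_centralizer_iff ℂ).1 hA Y hY').1).symm

/-- As in the double commutant theorem: the projection onto this closed subspace commutes with the
self-adjoint generators, hence with `A`. -/
theorem apply_mem_closure_of_mem_generatedVN {S : Set (H →L[ℂ] H)} (hS : ∀ X ∈ S, star X = X)
    {A : H →L[ℂ] H} (hA : A ∈ (generatedVN S).toStarSubalgebra) (h : H) :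
    A h ∈ closure {ξ | ∃ P ∈ StarAlgebra.adjoin ℂ S, ξ = P h} := by
  let E : Submodule ℂ H := (StarAlgebra.adjoin ℂ S).toSubalgebra.toSubmodule.map
    (ContinuousLinearMap.apply ℂ H h).toLinearMap
  have hE : (E : Set H) = {ξ | ∃ P ∈ StarAlgebra.adjoin ℂ S, ξ = P h} := by
    ext ξ
    exact ⟨fun ⟨P, hP, hξ⟩ => ⟨P, hP, hξ.symm⟩, fun ⟨P, hP, hξ⟩ => ⟨P, hP, hξ.symm⟩⟩
  rw [← hE, ← Submodule.topologicalClosure_coe]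
  set F := E.topologicalClosure
  have hF : CompleteSpace F := (Submodule.isClosed_topologicalClosure E).completeSpace_coe
  have hinv (X) (hX : X ∈ S) (ξ : H) (hξ : ξ ∈ F) : X ξ ∈ F := by
    refine map_mem_closure X.continuous hξ ?_
    rintro _ ⟨P, hP, rfl⟩
    have hXP : X * P ∈ StarAlgebra.adjoin ℂ S := mul_mem (StarAlgebra.subset_adjoin ℂ S hX) hP
    exact ⟨X * P, hXP, rfl⟩
  have hcomm (X) (hX : X ∈ S) : X * F.starProjection = F.starProjection * X := by
    ext1 ξ
    refine (Submodule.eq_starProjection_of_mem_of_inner_eq_zero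
      (hinv X hX _ (F.starProjection_apply_mem ξ)) fun η hη => ?_).symm
    have h1 := Submodule.starProjection_inner_eq_zero ξ (X η) (hinv X hX η hη)
    change ⟪X ξ - X (F.starProjection ξ), η⟫_ℂ = 0
    rw [← map_sub, ← hS X hX, ContinuousLinearMap.star_eq_adjoint,
      ContinuousLinearMap.adjoint_inner_left]
    exact h1
  have hh : h ∈ F := subset_closure ⟨1, one_mem (StarAlgebra.adjoin ℂ S), rfl⟩
  have hAF := congrArg (fun B : H →L[ℂ] H => B h) (mul_comm_of_mem_generatedVN hS hA hcomm)
  change A (F.starProjection h) = F.starProjection (A h) at hAF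
  rw [Submodule.starProjection_eq_self_iff.2 hh] at hAF
  rw [hAF]
  exact F.starProjection_apply_mem _

theorem inner_star_mul_apply (h : H) (C D : H →L[ℂ] H) :
    ⟪h, (star C * D) h⟫_ℂ = ⟪C h, D h⟫_ℂ := by
  change ⟪h, (star C) (D h)⟫_ℂ = _
  rw [ContinuousLinearMap.star_eq_adjoint, ContinuousLinearMap.adjoint_inner_right]

theorem inner_star_apply (h : H) (C : H →L[ℂ] H) :
    ⟪h, star C h⟫_ℂ = (starRingEnd ℂ) ⟪h, C h⟫_ℂ := by
  rw [ContinuousLinearMap.star_eq_adjoint, ContinuousLinearMap.adjoint_inner_right,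
    inner_conj_symm]

/-- Quantifying over all `A ∈ M` lets the product case move one factor at a time around the trace.
-/
theorem inner_mul_comm_of_mem_adjoin {M : StarSubalgebra ℂ (H →L[ℂ] H)} {S : Set (H →L[ℂ] H)}
    (hle : StarAlgebra.adjoin ℂ S ≤ M) (h : H)
    (hX : ∀ X ∈ S, ∀ A ∈ M, ⟪h, (A * X) h⟫_ℂ = ⟪h, (X * A) h⟫_ℂ)
    {P : H →L[ℂ] H} (hP : P ∈ StarAlgebra.adjoin ℂ S) :
    ∀ A ∈ M, ⟪h, (A * P) h⟫_ℂ = ⟪h, (P * A) h⟫_ℂ := by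
  induction hP using StarAlgebra.adjoin_induction with
  | mem X hX' => exact hX X hX'
  | algebraMap r => intro A _; rw [Algebra.commutes]
  | add P Q hP hQ ihP ihQ =>
    intro A hA
    simp only [mul_add, add_mul, add_apply, inner_add_right, ihP A hA, ihQ A hA]
  | mul P Q hP hQ ihP ihQ =>
    intro A hA
    rw [← mul_assoc, ihQ _ (mul_mem hA (hle hP)), ← mul_assoc, ihP _ (mul_mem (hle hQ) hA),
      mul_assoc]
  | star P hP ih =>
    intro A hA
    have := congrArg (starRingEnd ℂ) (ih _ (star_mem hA))
    rw [← inner_star_apply, ← inner_star_apply, star_mul, star_mul, star_star] at this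
    exact this.symm

theorem inner_mul_comm_of_star_mul_self {M : StarSubalgebra ℂ (H →L[ℂ] H)} (h : H)
    (hM : ∀ Z ∈ M, ⟪h, (star Z * Z) h⟫_ℂ = ⟪h, (Z * star Z) h⟫_ℂ) {A B : H →L[ℂ] H}
    (hA : A ∈ M) (hB : B ∈ M) : ⟪h, (A * B) h⟫_ℂ = ⟪h, (B * A) h⟫_ℂ := by
  have h1 := hM (star A + B) (add_mem (star_mem hA) hB)
  have h2 := hM (star A + Complex.I • B) (add_mem (star_mem hA) (M.smul_mem hB Complex.I))
  have hA' := hM _ (star_mem hA)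
  have hB' := hM _ hB
  simp only [star_add, star_star, star_smul, mul_add, add_mul, add_apply, inner_add_right,
    smul_mul_assoc, mul_smul_comm, smul_apply, inner_smul_right] at h1 h2 hA' hB'
  simp only [RCLike.star_def, Complex.conj_I] at h2
  -- Polarization: `(h1 - i h2) / 2` keeps the terms in `A B` and `B A` and cancels those in `B^*
  -- A^*` and `A^* B^*`; `hA'` and `hB'` remove the diagonal terms.
  linear_combination (1 / 2) * h1 - (Complex.I / 2) * h2 - (1 - Complex.I) / 2 * (hA' + hB') +
    ((⟪h, (A * B) h⟫_ℂ - ⟪h, (B * A) h⟫_ℂ - ⟪h, (star B * star A) h⟫_ℂ +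
      ⟪h, (star A * star B) h⟫_ℂ) / 2 - Complex.I / 2 *
        (⟪h, (star B * B) h⟫_ℂ - ⟪h, (B * star B) h⟫_ℂ)) * Complex.I_sq

theorem norm_star_apply_eq_of_inner {C : H →L[ℂ] H} {h : H}
    (hC : ⟪h, (star C * C) h⟫_ℂ = ⟪h, (C * star C) h⟫_ℂ) : ‖star C h‖ = ‖C h‖ := by
  rw [inner_star_mul_apply] at hC
  nth_rw 3 [← star_star C] at hC
  rw [inner_star_mul_apply, inner_self_eq_norm_sq_to_K, inner_self_eq_norm_sq_to_K] at hC
  norm_cast at hC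
  exact ((sq_eq_sq₀ (norm_nonneg _) (norm_nonneg _)).1 hC).symm

/-- For `P` in the generated star algebra, `⟨Z^* h, P h⟩ = ⟨P^* h, Z h⟩` and `‖P^* h‖ = ‖P h‖`. The
resulting Cauchy–Schwarz bound passes to the closure and is evaluated at `Z^* h`. -/
theorem norm_star_apply_le {M : StarSubalgebra ℂ (H →L[ℂ] H)} {S : Set (H →L[ℂ] H)}
    (hle : StarAlgebra.adjoin ℂ S ≤ M) (h : H)
    (hX : ∀ X ∈ S, ∀ A ∈ M, ⟪h, (A * X) h⟫_ℂ = ⟪h, (X * A) h⟫_ℂ)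
    {Z : H →L[ℂ] H} (hZ : Z ∈ M)
    (hcl : star Z h ∈ closure {ξ | ∃ P ∈ StarAlgebra.adjoin ℂ S, ξ = P h}) :
    ‖star Z h‖ ≤ ‖Z h‖ := by
  have key : ∀ ξ ∈ closure {ξ | ∃ P ∈ StarAlgebra.adjoin ℂ S, ξ = P h},
      ‖⟪star Z h, ξ⟫_ℂ‖ ≤ ‖ξ‖ * ‖Z h‖ := by
    have hc : IsClosed {ξ | ‖⟪star Z h, ξ⟫_ℂ‖ ≤ ‖ξ‖ * ‖Z h‖} :=
      isClosed_le (by fun_prop) (by fun_prop)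
    refine fun ξ hξ => closure_minimal ?_ hc hξ
    rintro _ ⟨P, hP, rfl⟩
    have hP' : ‖star P h‖ = ‖P h‖ := norm_star_apply_eq_of_inner
      (inner_mul_comm_of_mem_adjoin hle h hX hP _ (star_mem (hle hP)))
    have hPZ : ⟪star Z h, P h⟫_ℂ = ⟪star P h, Z h⟫_ℂ := by
      rw [← inner_star_mul_apply, ← inner_star_mul_apply, star_star, star_star]
      exact inner_mul_comm_of_mem_adjoin hle h hX hP Z hZ
    change ‖⟪star Z h, P h⟫_ℂ‖ ≤ ‖P h‖ * ‖Z h‖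
    rw [hPZ, ← hP']
    exact norm_inner_le_norm _ _
  have h1 := key _ hcl
  rw [inner_self_eq_norm_sq_to_K, norm_pow, pow_two] at h1
  simp only [RCLike.norm_ofReal, abs_norm] at h1
  by_cases h0 : ‖star Z h‖ = 0
  · rw [h0]; positivity
  · exact le_of_mul_le_mul_left h1 (lt_of_le_of_ne (norm_nonneg _) (Ne.symm h0))

/-- A vector state that is tracial on products with a generator is tracial. -/
theorem inner_mul_comm_of_generators {S : Set (H →L[ℂ] H)} (hS : ∀ X ∈ S, star X = X) (h : H)
    (hX : ∀ X ∈ S, ∀ A ∈ (generatedVN S).toStarSubalgebra, ⟪h, (A * X) h⟫_ℂ = ⟪h, (X * A) h⟫_ℂ)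
    {A B : H →L[ℂ] H} (hA : A ∈ (generatedVN S).toStarSubalgebra)
    (hB : B ∈ (generatedVN S).toStarSubalgebra) :
    ⟪h, (A * B) h⟫_ℂ = ⟪h, (B * A) h⟫_ℂ := by
  have hle : StarAlgebra.adjoin ℂ S ≤ (generatedVN S).toStarSubalgebra :=
    StarAlgebra.adjoin_le (subset_generatedVN S)
  have hnorm_le (Z) (hZ : Z ∈ (generatedVN S).toStarSubalgebra) : ‖star Z h‖ ≤ ‖Z h‖ :=
    norm_star_apply_le hle h hX hZ (apply_mem_closure_of_mem_generatedVN hS (star_mem hZ) h)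
  refine inner_mul_comm_of_star_mul_self h (fun Z hZ => ?_) hA hB
  have h1 := hnorm_le _ (star_mem hZ)
  rw [star_star] at h1
  have h2 := le_antisymm h1 (hnorm_le Z hZ)
  have h3 := inner_star_mul_apply h (star Z) (star Z)
  rw [star_star] at h3
  rw [h3, inner_star_mul_apply, inner_self_eq_norm_sq_to_K, inner_self_eq_norm_sq_to_K, h2]

end Generated

/-! ### Intertwiners -/

/-- The operator `a⁺(g) + a⁻(g) + c (1 - P)`, where `P` is the projection onto the vacuum. -/
def fieldOp (g : OneParticle) (c : ℂ) : Fock →L[ℂ] Fock :=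
  creation g + annihilation g + c • (1 - projVacuum)

/-- The semicircular operator `a⁺(g) + a⁻(g)`, shifted by `c`. -/
def shiftedOp (g : OneParticle) (c : ℂ) : Fock →L[ℂ] Fock :=
  creation g + annihilation g + c • 1

/-- The right semicircular operator `r⁺(f) + r⁻(f)`. -/
def rightOp (f : OneParticle) : Fock →L[ℂ] Fock := rightCreation f + rightAnnihilation f

theorem star_rightOp (f : OneParticle) : star (rightOp f) = rightOp f := by
  rw [rightOp, star_add, star_rightCreation, star_rightAnnihilation, add_comm]

theorem star_fieldOp (g : OneParticle) (c : ℝ) : star (fieldOp g c) = fieldOp g c := by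
  simp [fieldOp, star_creation, star_annihilation, star_projVacuum, add_comm]

theorem star_shiftedOp (g : OneParticle) (c : ℝ) : star (shiftedOp g c) = shiftedOp g c := by
  simp [shiftedOp, star_creation, star_annihilation, add_comm]

/-- Tensors ending in `h` have no vacuum component, so `1 - P` acts as the identity on them;
orthogonality prevents `a⁻(g)` from seeing `h`. -/
theorem fieldOp_mul_rightCreation {g h : OneParticle} (c : ℂ) (hgh : ⟪g, h⟫_ℂ = 0) :
    fieldOp g c * rightCreation h = rightCreation h * shiftedOp g c := by
  simp only [fieldOp, shiftedOp, add_mul, mul_add, smul_mul_assoc, mul_smul_comm, sub_mul,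
    one_mul, mul_one, projVacuum_mul_rightCreation, annihilation_mul_rightCreation,
    creation_mul_rightCreation, hgh, zero_smul, add_zero, sub_zero]

theorem rightAnnihilation_mul_fieldOp {g h : OneParticle} (c : ℝ) (hgh : ⟪g, h⟫_ℂ = 0) :
    rightAnnihilation h * fieldOp g c = shiftedOp g c * rightAnnihilation h := by
  rw [← star_inj, star_mul, star_mul, star_fieldOp, star_shiftedOp, star_rightAnnihilation,
    fieldOp_mul_rightCreation _ hgh]

/-- Commuting `r⁻(e)` past `a⁺(g)` produces `⟨e, g⟩ P`, exactly the term missing from `⟨e, g⟩ (1 -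
P)`. -/
theorem one_add_rightAnnihilation_mul_fieldOp (e g : OneParticle) :
    (1 + rightAnnihilation e) * fieldOp g ⟪e, g⟫_ℂ =
      shiftedOp g ⟪e, g⟫_ℂ * (1 + rightAnnihilation e) := by
  simp only [fieldOp, shiftedOp, add_mul, mul_add, smul_mul_assoc, mul_smul_comm, mul_sub,
    one_mul, mul_one, rightAnnihilation_mul_projVacuum, rightAnnihilation_mul_creation,
    annihilation_mul_rightAnnihilation, smul_sub, smul_add, smul_zero]
  abel

/-- The vacuum terms from `a⁻(g) r⁺(f)` and `r⁻(f) a⁺(g)` cancel when the inner product is real. -/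
theorem shiftedOp_mul_rightOp {g f : OneParticle} (c : ℂ) (hgf : ⟪g, f⟫_ℂ = ⟪f, g⟫_ℂ) :
    shiftedOp g c * rightOp f = rightOp f * shiftedOp g c := by
  simp only [rightOp, shiftedOp, add_mul, mul_add, smul_mul_assoc, mul_smul_comm,
    one_mul, mul_one, rightAnnihilation_mul_creation, annihilation_mul_rightCreation,
    annihilation_mul_rightAnnihilation, creation_mul_rightCreation, hgf, smul_add]
  abel

/-- The indicator function of a set of finite measure. -/
abbrev ind (s : Set ℝ) (hs : MeasurableSet s) (hs' : halfLine s ≠ ∞) : OneParticle :=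
  indicatorConstLp 2 hs hs' 1

theorem inner_ind (s t : Set ℝ) (hs : MeasurableSet s) (hs' : halfLine s ≠ ∞)
    (ht : MeasurableSet t) (ht' : halfLine t ≠ ∞) :
    ⟪ind s hs hs', ind t ht ht'⟫_ℂ = halfLine.real (s ∩ t) :=
  L2.inner_indicatorConstLp_one_indicatorConstLp_one _ _ _ _

theorem inner_ind_comm (s t : Set ℝ) (hs : MeasurableSet s) (hs' : halfLine s ≠ ∞)
    (ht : MeasurableSet t) (ht' : halfLine t ≠ ∞) :
    ⟪ind s hs hs', ind t ht ht'⟫_ℂ = ⟪ind t ht ht', ind s hs hs'⟫_ℂ := by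
  rw [inner_ind, inner_ind, Set.inter_comm]

/-- `X` is the operator `a⁺(g) + a⁻(g) + ⟨e, g⟩ (1 - P)` for an indicator function `g` which is
orthogonal to `h` and has a real inner product with `e`. -/
def IsFieldOp (e h : OneParticle) (X : Fock →L[ℂ] Fock) : Prop :=
  ∃ (s : Set ℝ) (hs : MeasurableSet s) (hs' : halfLine s ≠ ∞) (c : ℝ),
    ⟪e, ind s hs hs'⟫_ℂ = c ∧ ⟪ind s hs hs', h⟫_ℂ = 0 ∧ X = fieldOp (ind s hs hs') c

section Intertwiners

variable {e h : OneParticle} {X : Fock →L[ℂ] Fock}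

theorem IsFieldOp.star_eq (hX : IsFieldOp e h X) : star X = X := by
  obtain ⟨s, hs, hs', c, -, -, rfl⟩ := hX
  exact star_fieldOp _ _

/-- One factor passes from field to shifted operator, the other back, so the product lies in the
commutant. -/
theorem IsFieldOp.mul_intertwiner (hX : IsFieldOp e h X) :
    X * (rightCreation h * (1 + rightAnnihilation e)) =
      rightCreation h * (1 + rightAnnihilation e) * X := by
  obtain ⟨s, hs, hs', c, hc, hh, rfl⟩ := hX
  rw [← mul_assoc, fieldOp_mul_rightCreation _ hh, mul_assoc, mul_assoc, ← hc,
    one_add_rightAnnihilation_mul_fieldOp]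

theorem IsFieldOp.mul_star_intertwiner (hX : IsFieldOp e h X) :
    X * ((1 + rightCreation e) * rightAnnihilation h) =
      (1 + rightCreation e) * rightAnnihilation h * X := by
  have := congrArg star hX.mul_intertwiner
  simpa [star_rightCreation, star_rightAnnihilation, hX.star_eq] using this.symm

theorem IsFieldOp.mul_rightOp (hX : IsFieldOp e h X) (t : Set ℝ) (ht : MeasurableSet t)
    (ht' : halfLine t ≠ ∞) :
    X * (rightCreation h * rightOp (ind t ht ht') * rightAnnihilation h) =
      rightCreation h * rightOp (ind t ht ht') * rightAnnihilation h * X := by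
  obtain ⟨s, hs, hs', c, hc, hh, rfl⟩ := hX
  rw [mul_assoc _ _ (fieldOp _ _), rightAnnihilation_mul_fieldOp _ hh, ← mul_assoc, ← mul_assoc,
    ← mul_assoc, fieldOp_mul_rightCreation _ hh, mul_assoc (rightCreation h) (shiftedOp _ _),
    shiftedOp_mul_rightOp _ (inner_ind_comm _ _ _ _ _ _)]
  simp only [mul_assoc]

end Intertwiners

/-! ### The vector state of `h`: trace property and separation -/

section VectorState

variable {e h : OneParticle} {S : Set (Fock →L[ℂ] Fock)} {A : Fock →L[ℂ] Fock}

theorem rightAnnihilation_rightCreation (hh : ⟪h, h⟫_ℂ = 1) (ξ : Fock) :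
    rightAnnihilation h (rightCreation h ξ) = ξ := by
  have := congrArg (fun B : Fock →L[ℂ] Fock => B ξ) (rightAnnihilation_mul_rightCreation h h)
  rwa [hh, one_smul] at this

theorem mul_comm_of_isFieldOp (hS : ∀ X ∈ S, IsFieldOp e h X)
    (hA : A ∈ (generatedVN S).toStarSubalgebra) {Y : Fock →L[ℂ] Fock}
    (hY : ∀ X, IsFieldOp e h X → X * Y = Y * X) (ξ : Fock) : A (Y ξ) = Y (A ξ) :=
  congrArg (fun B : Fock →L[ℂ] Fock => B ξ)
    (mul_comm_of_mem_generatedVN (fun X hX => (hS X hX).star_eq) hA fun X hX => hY X (hS X hX))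

theorem apply_rightCreation_vacuum (hS : ∀ X ∈ S, IsFieldOp e h X)
    (hA : A ∈ (generatedVN S).toStarSubalgebra) :
    A (rightCreation h vacuum) = rightCreation h ((1 + rightAnnihilation e) (A vacuum)) := by
  simpa [rightAnnihilation_vacuum] using
    mul_comm_of_isFieldOp hS hA (fun X hX => hX.mul_intertwiner) vacuum

theorem apply_one_add_rightCreation (hS : ∀ X ∈ S, IsFieldOp e h X)
    (hA : A ∈ (generatedVN S).toStarSubalgebra) (hh : ⟪h, h⟫_ℂ = 1) (ξ : Fock) :
    A ((1 + rightCreation e) ξ) =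
      (1 + rightCreation e) (rightAnnihilation h (A (rightCreation h ξ))) := by
  have := mul_comm_of_isFieldOp hS hA (fun X hX => hX.mul_star_intertwiner) (rightCreation h ξ)
  change A ((1 + rightCreation e) (rightAnnihilation h (rightCreation h ξ))) = _ at this
  rwa [rightAnnihilation_rightCreation hh] at this

/-- The vector state of `h` equals the functional `A ↦ ⟨Ω, A (Ω + e)⟩`. -/
theorem inner_rightCreation_vacuum (hS : ∀ X ∈ S, IsFieldOp e h X)
    (hA : A ∈ (generatedVN S).toStarSubalgebra) (hh : ⟪h, h⟫_ℂ = 1) :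
    ⟪vacuum, A (vacuum + creation e vacuum)⟫_ℂ =
      ⟪rightCreation h vacuum, A (rightCreation h vacuum)⟫_ℂ := by
  have h1 := apply_one_add_rightCreation hS hA hh vacuum
  rw [add_apply, rightCreation_vacuum e] at h1
  refine (congrArg (fun ξ => ⟪vacuum, ξ⟫_ℂ) h1).trans ?_
  -- The range of `r⁺(e)` is orthogonal to the vacuum, so only the summand `1` contributes.
  rw [add_apply, inner_add_right, ← star_rightAnnihilation e,
    ContinuousLinearMap.star_eq_adjoint, ContinuousLinearMap.adjoint_inner_right,
    rightAnnihilation_vacuum, inner_zero_left, add_zero]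
  exact inner_rightAnnihilation_right _ _ _

/-- On `v = h` a generator acts as `Y + c`, with `c` real and `Y` self-adjoint in the commutant.
Thus `X` can be carried past `A` and across the inner product. -/
theorem inner_mul_comm_rightCreation_vacuum (hS : ∀ X ∈ S, IsFieldOp e h X)
    (hA : A ∈ (generatedVN S).toStarSubalgebra) (hh : ⟪h, h⟫_ℂ = 1) {B : Fock →L[ℂ] Fock}
    (hB : B ∈ (generatedVN S).toStarSubalgebra) :
    ⟪rightCreation h vacuum, (A * B) (rightCreation h vacuum)⟫_ℂ =
      ⟪rightCreation h vacuum, (B * A) (rightCreation h vacuum)⟫_ℂ := by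
  refine inner_mul_comm_of_generators (fun X hX => (hS X hX).star_eq) _
    (fun X hX A hA => ?_) hA hB
  obtain ⟨s, hs, hs', c, hc, hgh, hXeq⟩ := hS X hX
  set v := rightCreation h vacuum with hv
  set Y := rightCreation h * rightOp (ind s hs hs') * rightAnnihilation h with hY
  have hYstar : star Y = Y := by
    rw [hY, star_mul, star_mul, star_rightOp, star_rightCreation, star_rightAnnihilation, mul_assoc]
  have hXv : X v = Y v + (c : ℂ) • v := by
    have h1 := congrArg (fun B : Fock →L[ℂ] Fock => B vacuum) (fieldOp_mul_rightCreation c hgh)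
    rw [hXeq, hv]
    refine h1.trans ?_
    change rightCreation h (creation _ vacuum + annihilation _ vacuum + (c : ℂ) • vacuum) =
      rightCreation h ((rightCreation _ + rightAnnihilation _)
        (rightAnnihilation h (rightCreation h vacuum))) + _
    rw [rightAnnihilation_rightCreation hh, add_apply, annihilation_vacuum,
      rightAnnihilation_vacuum, rightCreation_vacuum, map_add, map_smul, add_zero]
  have hAY : A (Y v) = Y (A v) :=
    mul_comm_of_isFieldOp hS hA (fun X hX => hX.mul_rightOp s hs hs') v
  have hX' : ⟪v, X (A v)⟫_ℂ = ⟪X v, A v⟫_ℂ := by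
    nth_rw 1 [← (hS X hX).star_eq]
    rw [ContinuousLinearMap.star_eq_adjoint, ContinuousLinearMap.adjoint_inner_right]
  have hY' : ⟪v, Y (A v)⟫_ℂ = ⟪Y v, A v⟫_ℂ := by
    nth_rw 1 [← hYstar]
    rw [ContinuousLinearMap.star_eq_adjoint, ContinuousLinearMap.adjoint_inner_right]
  change ⟪v, A (X v)⟫_ℂ = ⟪v, X (A v)⟫_ℂ
  rw [hX', hXv, map_add, map_smul, hAY, inner_add_right, inner_add_left, hY', inner_smul_left,
    inner_smul_right, Complex.conj_ofReal]

/-- The kernel of `A r⁺(h)` contains `Ω` and is stable under right semicircular operators, because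
`A` commutes with `r⁺(h) R r⁻(h)` and `r⁻(h) r⁺(h) = 1`. Cyclicity makes it everything. -/
theorem eq_zero_of_apply_rightCreation_vacuum (hS : ∀ X ∈ S, IsFieldOp e h X)
    (hA : A ∈ (generatedVN S).toStarSubalgebra) (hh : ⟪h, h⟫_ℂ = 1) (he : ‖e‖ ≤ 1)
    (h0 : A (rightCreation h vacuum) = 0) : A = 0 := by
  have htop : (A * rightCreation h).toLinearMap.ker = ⊤ := by
    refine eq_top_of_vacuum_mem_right _ (ContinuousLinearMap.isClosed_ker (A * rightCreation h))
      h0 fun s hs hs' ζ hζ => ?_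
    have h1 := mul_comm_of_isFieldOp hS hA (fun X hX => hX.mul_rightOp s hs hs')
      (rightCreation h ζ)
    have hζ' : A (rightCreation h ζ) = 0 := hζ
    rw [hζ', map_zero] at h1
    change A (rightCreation h (rightOp _ (rightAnnihilation h (rightCreation h ζ)))) = 0 at h1
    rwa [rightAnnihilation_rightCreation hh] at h1
  have h1 (ξ : Fock) : A (rightCreation h ξ) = 0 := by
    have : ξ ∈ (A * rightCreation h).toLinearMap.ker := htop ▸ Submodule.mem_top
    exact this
  have h2 : A * (1 + rightCreation e) = 0 := by
    ext1 ξ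
    refine (apply_one_add_rightCreation hS hA hh ξ).trans ?_
    rw [h1, map_zero, map_zero]
    rfl
  rw [← star_eq_zero]
  ext1 ξ
  refine eq_zero_of_rightAnnihilation_eq_neg he ?_
  have h3 := congrArg (fun B => (star B : Fock →L[ℂ] Fock) ξ) h2
  simp only [star_mul, star_add, star_one, star_rightCreation, star_zero] at h3
  exact eq_neg_of_add_eq_zero_right h3

theorem eq_zero_of_apply_vacuum (hS : ∀ X ∈ S, IsFieldOp e h X)
    (hA : A ∈ (generatedVN S).toStarSubalgebra) (hh : ⟪h, h⟫_ℂ = 1) (he : ‖e‖ ≤ 1)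
    (h0 : A vacuum = 0) : A = 0 := by
  refine eq_zero_of_apply_rightCreation_vacuum hS hA hh he ?_
  rw [apply_rightCreation_vacuum hS hA, h0, map_zero, map_zero]

end VectorState

/-! ### The states -/

theorem isNormal_of_eq_inner {H : Type*} [NormedAddCommGroup H] [InnerProductSpace ℂ H]
    [CompleteSpace H] {M : VonNeumannAlgebra H} (f : M.toStarSubalgebra →ₗ[ℂ] ℂ) (ξ η : H)
    (hf : ∀ A, f A = ⟪ξ, (A : H →L[ℂ] H) η⟫_ℂ) : IsNormal f := by
  -- Sequences supported at index `0` reduce the ultraweak series to a single vector functional.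
  let ξ' : lp (fun _ : ℕ => H) 2 := lp.single 2 0 ξ
  let η' : lp (fun _ : ℕ => H) 2 := lp.single 2 0 η
  have hcont : Continuous[ultraweak, inferInstance]
      fun A : H →L[ℂ] H => ∑' n, ⟪ξ' n, A (η' n)⟫_ℂ :=
    continuous_iInf_dom (i := ξ') (continuous_iInf_dom (i := η') continuous_induced_dom)
  have heq : (f : M.toStarSubalgebra → ℂ) =
      (fun A : H →L[ℂ] H => ∑' n, ⟪ξ' n, A (η' n)⟫_ℂ) ∘ Subtype.val := by
    funext A
    rw [hf, Function.comp_apply, tsum_eq_single 0]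
    · rw [lp.single_apply_self, lp.single_apply_self]
    · intro n hn
      rw [lp.single_apply_ne _ _ _ hn, inner_zero_left]
  unfold IsNormal
  rw [heq]
  exact @Continuous.comp _ _ _ (TopologicalSpace.induced Subtype.val ultraweak) ultraweak _ _ _
    hcont (@continuous_induced_dom _ _ _ ultraweak)

theorem inner_coe_star_mul_self {H : Type*} [NormedAddCommGroup H] [InnerProductSpace ℂ H]
    [CompleteSpace H] {M : VonNeumannAlgebra H} (a : M.toStarSubalgebra) (ξ : H) :
    ⟪ξ, ((star a * a : M.toStarSubalgebra) : H →L[ℂ] H) ξ⟫_ℂ =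
      ((‖(a : H →L[ℂ] H) ξ‖ ^ 2 : ℝ) : ℂ) := by
  have h := inner_star_mul_apply ξ (a : H →L[ℂ] H) (a : H →L[ℂ] H)
  rw [inner_self_eq_norm_sq_to_K] at h
  push_cast
  exact h

theorem isState_of_eq_inner {H : Type*} [NormedAddCommGroup H] [InnerProductSpace ℂ H]
    [CompleteSpace H] {M : VonNeumannAlgebra H} (f : M.toStarSubalgebra →ₗ[ℂ] ℂ) (ξ : H)
    (hξ : ⟪ξ, ξ⟫_ℂ = 1) (hf : ∀ A, f A = ⟪ξ, (A : H →L[ℂ] H) ξ⟫_ℂ) : IsState f := by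
  refine ⟨(hf 1).trans hξ, fun a => ?_⟩
  rw [hf, inner_coe_star_mul_self]
  exact ⟨by rw [Complex.ofReal_re]; positivity, Complex.ofReal_im _⟩

theorem isFaithful_of_eq_inner {H : Type*} [NormedAddCommGroup H] [InnerProductSpace ℂ H]
    [CompleteSpace H] {M : VonNeumannAlgebra H} (f : M.toStarSubalgebra →ₗ[ℂ] ℂ) (ξ : H)
    (hf : ∀ A, f A = ⟪ξ, (A : H →L[ℂ] H) ξ⟫_ℂ)
    (hsep : ∀ A ∈ M.toStarSubalgebra, A ξ = 0 → A = 0) : IsFaithful f := by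
  intro a ha
  rw [hf, inner_coe_star_mul_self, Complex.ofReal_eq_zero, sq_eq_zero_iff, norm_eq_zero] at ha
  exact Subtype.ext (hsep a a.2 ha)

/-! ### The process as field operators -/

theorem halfLine_real_Ico {a b : ℝ} (ha : 0 ≤ a) (hab : a ≤ b) :
    halfLine.real (Set.Ico a b) = b - a := by
  have hsub : Set.Ico a b ∩ Set.Ici 0 = Set.Ico a b :=
    Set.inter_eq_left.2 fun x hx => ha.trans hx.1
  rw [halfLine, measureReal_restrict_apply measurableSet_Ico, hsub, Real.volume_real_Ico_of_le hab]

theorem halfLine_Ico_ne_top' (a b : ℝ) : halfLine (Set.Ico a b) ≠ ∞ :=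
  ((Measure.restrict_apply_le _ _).trans_lt measure_Ico_lt_top).ne

theorem inner_ind_Ico_zero {s t : ℝ} (ht : 0 ≤ t) (hts : t ≤ s) :
    ⟪ind (Set.Ico 0 s) measurableSet_Ico (halfLine_Ico_ne_top s),
      ind (Set.Ico 0 t) measurableSet_Ico (halfLine_Ico_ne_top t)⟫_ℂ = t := by
  rw [inner_ind, Set.Ico_inter_Ico, max_self, min_eq_right hts, halfLine_real_Ico le_rfl ht,
    sub_zero]

theorem process_eq_fieldOp (α : ℝ) {t : ℝ} (ht : 0 ≤ t) :
    process α t = fieldOp (ind (Set.Ico 0 t) measurableSet_Ico (halfLine_Ico_ne_top t))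
      ((α * t : ℝ) : ℂ) := by
  have hint : ∫ x, (ind (Set.Ico 0 t) measurableSet_Ico (halfLine_Ico_ne_top t)) x ∂halfLine
      = (t : ℂ) := by
    rw [integral_indicatorConstLp, halfLine_real_Ico le_rfl ht, sub_zero]
    simp
  unfold process field
  rw [hint, Complex.ofReal_mul]
  rfl

theorem tensor_smul_left {n : ℕ} (c : ℂ) (g : OneParticle) (f : Particles n) :
    tensor (c • g) f = c • tensor g f := by
  have hq : Measure.QuasiMeasurePreserving (fun x : Fin (n + 1) → ℝ => x 0)
      (orthant (n + 1)) halfLine :=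
    Measure.quasiMeasurePreserving_fst.comp (measurePreserving_headTail n).quasiMeasurePreserving
  apply Lp.ext
  filter_upwards [coeFn_tensor (c • g) f, coeFn_tensor g f, Lp.coeFn_smul c (tensor g f),
    hq.ae (Lp.coeFn_smul c g)] with x h1 h2 h3 h4
  rw [h1, h3, Pi.smul_apply, h2, h4, Pi.smul_apply, smul_eq_mul, smul_eq_mul, mul_assoc]

theorem creation_smul_apply (c : ℂ) (g : OneParticle) (ξ : Fock) :
    creation (c • g) ξ = c • creation g ξ := by
  ext1
  funext n
  rcases n with _ | n
  · exact (smul_zero c).symm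
  · exact tensor_smul_left c g (ξ n)

theorem correction_vacuum (α : ℝ) {T : ℝ} (hT : 0 ≤ T) :
    correction α T vacuum = vacuum +
      creation ((α : ℂ) • ind (Set.Ico 0 T) measurableSet_Ico (halfLine_Ico_ne_top T)) vacuum := by
  have h2 : process α T vacuum =
      creation (ind (Set.Ico 0 T) measurableSet_Ico (halfLine_Ico_ne_top T)) vacuum := by
    rw [process_eq_fieldOp α hT]
    simp [fieldOp, annihilation_vacuum, projVacuum_vacuum]
  rw [creation_smul_apply, ← h2]
  rfl

end TwoStateFree

end

open TwoStateFree in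
theorem mainTheorem6 (α : ℝ) (hα : α ≠ 0) (T : ℝ) (hT : T = 1 / α ^ 2) :
    (TwoStateFree.IsState (TwoStateFree.phi α T) ∧
      TwoStateFree.IsNormal (TwoStateFree.phi α T) ∧
      TwoStateFree.IsFaithful (TwoStateFree.phi α T)) ∧
    (TwoStateFree.IsState (TwoStateFree.psi α T) ∧
      TwoStateFree.IsNormal (TwoStateFree.psi α T) ∧
      TwoStateFree.IsFaithful (TwoStateFree.psi α T) ∧
      TwoStateFree.IsTracial (TwoStateFree.psi α T)) := by
  have hT0 : 0 ≤ T := by rw [hT]; positivity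
  have hαT : α * α * T = 1 := by rw [hT]; field_simp
  let u := ind (Set.Ico 0 T) measurableSet_Ico (halfLine_Ico_ne_top T)
  -- Chosen so that `⟨e, 1_[0,t)⟩ = α t` is the coefficient in `X(t)` for `t ≤ T`, and `C_T Ω = Ω +
  -- e`.
  let e : OneParticle := (α : ℂ) • u
  -- Any unit indicator supported beyond `T` would serve: the algebra only involves functions on
  -- `[0, T)`.
  let h : OneParticle := ind (Set.Ico T (T + 1)) measurableSet_Ico (halfLine_Ico_ne_top' _ _)
  have hh : ⟪h, h⟫_ℂ = 1 := by
    rw [inner_ind, Set.inter_self, halfLine_real_Ico hT0 (by linarith)]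
    simp
  have he : ‖e‖ ≤ 1 := by
    have hee : ⟪e, e⟫_ℂ = 1 := by
      rw [inner_smul_left, inner_smul_right, inner_ind_Ico_zero hT0 le_rfl, Complex.conj_ofReal]
      exact_mod_cast (mul_assoc α α T).symm.trans hαT
    have hn := inner_self_eq_norm_sq (𝕜 := ℂ) e
    rw [hee, RCLike.one_re] at hn
    exact (sq_le_one_iff₀ (norm_nonneg e)).1 hn.ge
  have hS : ∀ X ∈ {A | ∃ t ∈ Set.Icc 0 T, A = process α t}, IsFieldOp e h X := by
    rintro _ ⟨t, ⟨ht0, htT⟩, rfl⟩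
    refine ⟨Set.Ico 0 t, measurableSet_Ico, halfLine_Ico_ne_top t, α * t, ?_, ?_,
      process_eq_fieldOp α ht0⟩
    · rw [inner_smul_left, inner_ind_Ico_zero ht0 htT, Complex.conj_ofReal, Complex.ofReal_mul]
    · rw [inner_ind, Set.Ico_inter_Ico, Set.Ico_eq_empty]
      · simp
      · simp only [not_lt]
        exact (min_le_left _ _).trans (htT.trans (le_max_right _ _))
  set v := rightCreation h vacuum with hv
  have hphi (A) : phi α T A = ⟪vacuum, (A : Fock →L[ℂ] Fock) vacuum⟫_ℂ := rfl
  have hpsi (A) : psi α T A = ⟪v, (A : Fock →L[ℂ] Fock) v⟫_ℂ := by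
    rw [hv, ← inner_rightCreation_vacuum hS A.2 hh, ← correction_vacuum α hT0]
    rfl
  have hvv : ⟪v, v⟫_ℂ = 1 := by
    rw [hv, ← inner_rightAnnihilation_right, rightAnnihilation_rightCreation hh,
      inner_vacuum_vacuum]
  refine ⟨⟨isState_of_eq_inner _ _ inner_vacuum_vacuum hphi, isNormal_of_eq_inner _ _ _ hphi,
    isFaithful_of_eq_inner _ _ hphi fun A hA h0 => eq_zero_of_apply_vacuum hS hA hh he h0⟩,
    isState_of_eq_inner _ _ hvv hpsi, isNormal_of_eq_inner _ _ _ hpsi,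
    isFaithful_of_eq_inner _ _ hpsi fun A hA h0 =>
      eq_zero_of_apply_rightCreation_vacuum hS hA hh he h0, fun A B => ?_⟩
  rw [hpsi, hpsi]
  exact inner_mul_comm_rightCreation_vacuum hS A.2 hh B.2
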